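/- Let $k,m\ge 1$ be integers and let $\lambda\in(0,1]$ be real. For $n\ge 1$ let $\mathcal F_{\lambda,n}$ be the family of all subsets of $\{1,\dots,n\}$ of size at most $\lambda n$. For a sequence $\Sigma=(a_1,\dots,a_n)$ in $\mathbb Z^k$ and $A\subseteq\{1,\dots,n\}$ put $$e^m_\Sigma(A)=\sum_{\substack{i_1<\dots<i_m\\ i_1,\dots,i_m\in A}}a_{i_1}\cdots a_{i_m}\in\mathbb Z^k,$$ with products taken coordinatewise (so $e^m_\Sigma(A)=0$ if $|A|<m$). For real $M$, call $\Sigma$ $M$-bounded if $a_i\in[0,M]^k$ for every $i$. Define $$C_{k,m,\lambda}=\begin{cases} \dfrac{((m-1)!)^2\,\Gamma(k/2+1)^{2/k}}{2(\lambda^{2m-1}+\lambda^{2m})\,\pi(k+2)} & \text{if }\lambda<1/2,\\[2ex] \dfrac{2^{2m}((m-1)!)^2\,\Gamma(k/2+1)^{2/k}}{(2^{2m+1}\lambda^{2m-1}+2^{2m+1}\lambda^{2m}+1)\,\pi(k+2)} & \text{if }\lambda=1/2,\\[2ex] \dfrac{(m!)^2\,\Gamma(k/2+1)^{2/k}}{(2m^2\lambda^{2m-1}+2m^2\lambda^{2m}+1)\,\pi(k+2)}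 & \text{if }\lambda>1/2. \end{cases}$$ Then there is a sequence of reals $\varepsilon_n\to 0$ as $n\to\infty$, depending only on $k,m,\lambda$, such that for every $n\ge1$, every real $M$, and every $M$-bounded sequence $\Sigma=(a_1,\dots,a_n)$ in $\mathbb Z^k$ satisfying $e^m_\Sigma(A_1)\ne e^m_\Sigma(A_2)$ for all distinct $A_1,A_2\in\mathcal F_{\lambda,n}$ of size at least $m$, $$M^{2m}\ \ge\ C_{k,m,\lambda}\,\frac{(1+\varepsilon_n)\,|\mathcal F_{\lambda,n}|^{2/k}}{n^{2m-1}}.$$ -/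

import Mathlib

namespace SymmEval

/-- `F lam n`: the family of all subsets of an `n`-element index set (here `Fin n`, standing for
`[1, n]`) whose size is at most `lam * n`. -/
noncomputable def smallSets (lam : ℝ) (n : ℕ) : Finset (Finset (Fin n)) :=
  Finset.univ.filter fun A => (A.card : ℝ) ≤ lam * n

/-- The `m`-th evaluation of the sequence `a` on `A`: the sum over all `m`-element subsets `s` of `A`
of the product of the `a i`, `i ∈ s`. Products in `ℤ^k = (Fin k → ℤ)` are taken coordinatewise,
and the value is `0` if `A` has fewer than `m` elements. -/
def eval {n k : ℕ} (m : ℕ) (a : Fin n → Fin k → ℤ) (A : Finset (Fin n)) : Fin k → ℤ :=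
  ∑ s ∈ A.powersetCard m, ∏ i ∈ s, a i

/-- Every entry of the sequence belongs to `[0, M]^k`. -/
def IsBounded {n k : ℕ} (M : ℝ) (a : Fin n → Fin k → ℤ) : Prop :=
  ∀ i j, 0 ≤ a i j ∧ (a i j : ℝ) ≤ M

/-- The evaluations on the members of `smallSets lam n` of size at least `m` are
pairwise distinct. -/
def IsEvalDistinct {n k : ℕ} (lam : ℝ) (m : ℕ) (a : Fin n → Fin k → ℤ) : Prop :=
  ∀ A₁ ∈ smallSets lam n, ∀ A₂ ∈ smallSets lam n, m ≤ A₁.card → m ≤ A₂.card →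
    A₁ ≠ A₂ → eval m a A₁ ≠ eval m a A₂

/-- The explicit constant of the lower bound. -/
noncomputable def boundConst (k m : ℕ) (lam : ℝ) : ℝ :=
  if lam < 1 / 2 then
    (((m - 1).factorial : ℝ) ^ 2 * Real.Gamma ((k : ℝ) / 2 + 1) ^ ((2 : ℝ) / k)) /
      (2 * (lam ^ (2 * m - 1) + lam ^ (2 * m)) * Real.pi * ((k : ℝ) + 2))
  else if lam = 1 / 2 then
    (2 ^ (2 * m) * ((m - 1).factorial : ℝ) ^ 2 *
        Real.Gamma ((k : ℝ) / 2 + 1) ^ ((2 : ℝ) / k)) /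
      ((2 ^ (2 * m + 1) * lam ^ (2 * m - 1) + 2 ^ (2 * m + 1) * lam ^ (2 * m) + 1) *
        Real.pi * ((k : ℝ) + 2))
  else
    ((m.factorial : ℝ) ^ 2 * Real.Gamma ((k : ℝ) / 2 + 1) ^ ((2 : ℝ) / k)) /
      ((2 * (m : ℝ) ^ 2 * lam ^ (2 * m - 1) + 2 * (m : ℝ) ^ 2 * lam ^ (2 * m) + 1) *
        Real.pi * ((k : ℝ) + 2))

end SymmEval

/-!
The proof compares two estimates of the second moment `∑ A, |eval m a A - c|²` about a fixed centre
`c`, where `A` runs over the family `smallSets lam n`, of cardinality `N`.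

*From below.* The sets with at least `m` elements have pairwise distinct evaluations, and these are
lattice points. A set of `N'` lattice points is spread out at least as much as a Euclidean ball of
volume `N'`, up to a correction of lower order for the unit cubes around the points
(`second_moment_lower_bound`). The sets with fewer than `m` elements form a vanishing proportion of
the family (`card_smallSets_lt_mul_le`).

*From above.* One coordinate at a time, weights in `[0, M]` are given. Among the sets of a fixed size
`s`, two disjoint `m`-sets are negatively correlated, so that only intersecting pairs of `m`-subsets
of `A` contribute to the variance; there are at most `s ^ (2m-1) / ((m-1)!)²` of them inside `A`
(`sum_slice_sq_le`). The mean over the sets of size `s` depends on `s` in a Lipschitz way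
(`sliceMean_sub_sq_le`), and the size of a small set has second moment at most
`(1 + 2 lam) lam n` about a suitable centre (`eventually_exists_sum_size_sq_le`): for `lam < 1/2` the
binomial coefficients decay geometrically below `lam n`, and for `lam ≥ 1/2` the family contains at
least half of all subsets. Altogether each coordinate contributes at most
`2 (lam ^ (2m-1) + lam ^ (2m)) M ^ (2m) n ^ (2m-1) / ((m-1)!)²` per set, which corresponds to the
constant of the case `lam < 1/2`; the constants of the other two cases are smaller
(`boundConst_le`).
-/

namespace SymmEval

open MeasureTheory Finset Filter

variable {n : ℕ}

/-! ### Second moments of finite sets of lattice points -/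

/-- The volume of the Euclidean unit ball of `ℝ^k`. -/
noncomputable def unitBallVolume (k : ℕ) : ℝ := √Real.pi ^ k / Real.Gamma ((k : ℝ) / 2 + 1)

lemma unitBallVolume_pos (k : ℕ) : 0 < unitBallVolume k :=
  div_pos (pow_pos (Real.sqrt_pos.2 Real.pi_pos) k) (Real.Gamma_pos_of_pos (by positivity))

lemma integral_Ioi_pow_mul_max {k : ℕ} (hk : 1 ≤ k) {R : ℝ} (hR : 0 ≤ R) :
    ∫ y in Set.Ioi (0 : ℝ), y ^ (k - 1) * max (R ^ 2 - y ^ 2) 0 =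
      2 * R ^ (k + 2) / (k * (k + 2)) := by
  obtain ⟨l, rfl⟩ := Nat.exists_eq_add_of_le' hk
  have h1 : ∫ y in Set.Ioi (0 : ℝ), y ^ (l + 1 - 1) * max (R ^ 2 - y ^ 2) 0 =
      ∫ y in Set.Ioc 0 R, y ^ l * (R ^ 2 - y ^ 2) := by
    rw [← integral_indicator measurableSet_Ioi, ← integral_indicator measurableSet_Ioc]
    congr 1
    ext y
    simp only [Set.indicator, Set.mem_Ioi, Set.mem_Ioc, Nat.add_sub_cancel]
    by_cases hy : 0 < y
    · by_cases hyR : y ≤ R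
      · rw [if_pos hy, if_pos ⟨hy, hyR⟩, max_eq_left (by nlinarith)]
      · rw [if_pos hy, if_neg (fun h => hyR h.2), max_eq_right (by nlinarith), mul_zero]
    · rw [if_neg hy, if_neg (fun h => hy h.1)]
  rw [h1, ← intervalIntegral.integral_of_le hR]
  have h2 : ∀ y : ℝ, y ^ l * (R ^ 2 - y ^ 2) = R ^ 2 * y ^ l - y ^ (l + 2) := fun y => by ring
  simp_rw [h2]
  rw [intervalIntegral.integral_sub (by apply Continuous.intervalIntegrable; fun_prop)
    (by apply Continuous.intervalIntegrable; fun_prop), intervalIntegral.integral_const_mul,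
    integral_pow, integral_pow]
  push_cast
  have : (l : ℝ) + 1 ≠ 0 := by positivity
  have : (l : ℝ) + 1 + 2 ≠ 0 := by positivity
  have : (l : ℝ) + 2 + 1 ≠ 0 := by positivity
  field_simp
  ring

/-- The integral of `(R² - |y - c|²)⁺` over `ℝ^k`, in polar coordinates. -/
lemma integral_max_sq_sub_dist_sq {k : ℕ} (hk : 1 ≤ k) (c : Fin k → ℝ) {R : ℝ} (hR : 0 ≤ R) :
    ∫ y : Fin k → ℝ, max (R ^ 2 - ∑ j, (y j - c j) ^ 2) 0 =
      unitBallVolume k * R ^ (k + 2) * (2 / (k + 2)) := by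
  have := Fin.pos_iff_nonempty.1 hk
  have h0 := integral_sub_right_eq_self (μ := volume)
    (fun y : Fin k → ℝ => max (R ^ 2 - ∑ j, (y j) ^ 2) 0) c
  simp only [Pi.sub_apply] at h0
  rw [h0, ← (EuclideanSpace.volume_preserving_symm_measurableEquiv_toLp (Fin k)).integral_comp
    (MeasurableEquiv.measurableEmbedding _)]
  have h1 : ∀ x : EuclideanSpace ℝ (Fin k),
      max (R ^ 2 - ∑ j, ((MeasurableEquiv.toLp 2 (Fin k → ℝ)).symm x j) ^ 2) 0 =
        (fun r : ℝ => max (R ^ 2 - r ^ 2) 0) ‖x‖ := by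
    intro x
    simp only [EuclideanSpace.real_norm_sq_eq]
    rfl
  simp_rw [h1]
  refine (integral_fun_norm_addHaar (volume : Measure (EuclideanSpace ℝ (Fin k)))
    (fun r : ℝ => max (R ^ 2 - r ^ 2) 0)).trans ?_
  have h2 : (volume : Measure (EuclideanSpace ℝ (Fin k))).real (Metric.ball 0 1) =
      unitBallVolume k := by
    rw [Measure.real, EuclideanSpace.volume_ball, unitBallVolume]
    simp only [ENNReal.ofReal_one, one_pow, one_mul, Fintype.card_fin]
    exact ENNReal.toReal_ofReal (unitBallVolume_pos k).le
  simp only [finrank_euclideanSpace, Fintype.card_fin, h2, smul_eq_mul, nsmul_eq_mul]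
  rw [integral_Ioi_pow_mul_max hk hR]
  have : (k : ℝ) ≠ 0 := by positivity
  field_simp

lemma integrable_max_sq_sub_dist_sq {k : ℕ} (c : Fin k → ℝ) (R : ℝ) :
    Integrable (fun y : Fin k → ℝ => max (R ^ 2 - ∑ j, (y j - c j) ^ 2) 0) := by
  apply Continuous.integrable_of_hasCompactSupport (by fun_prop)
  refine HasCompactSupport.intro
    (isCompact_univ_pi fun j => isCompact_Icc (a := c j - |R|) (b := c j + |R|)) ?_
  intro y hy
  rw [Set.mem_univ_pi, not_forall] at hy
  obtain ⟨j, hj⟩ := hy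
  apply max_eq_right
  have h1 : (y j - c j) ^ 2 ≤ ∑ j, (y j - c j) ^ 2 :=
    single_le_sum (f := fun j => (y j - c j) ^ 2) (fun i _ => sq_nonneg _) (mem_univ j)
  have h2 : R ^ 2 ≤ (y j - c j) ^ 2 := by
    rw [sq_le_sq]
    by_contra h
    rw [not_le, abs_lt] at h
    exact hj ⟨by linarith [h.1], by linarith [h.2]⟩
  linarith

/-- The half-open unit cube of `ℝ^k` centred at the lattice point `x`. -/
def unitCube {k : ℕ} (x : Fin k → ℤ) : Set (Fin k → ℝ) :=
  Set.univ.pi fun j => Set.Ioc ((x j : ℝ) - 1 / 2) (x j + 1 / 2)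

lemma measurableSet_unitCube {k : ℕ} (x : Fin k → ℤ) : MeasurableSet (unitCube x) :=
  MeasurableSet.univ_pi fun _ => measurableSet_Ioc

lemma disjoint_unitCube {k : ℕ} {x y : Fin k → ℤ} (h : x ≠ y) :
    Disjoint (unitCube x) (unitCube y) := by
  rw [Set.disjoint_left]
  intro z hx hy
  apply h
  ext j
  have h1 := hx j trivial
  have h2 := hy j trivial
  simp only [Set.mem_Ioc] at h1 h2
  have h3 : (x j : ℝ) < y j + 1 := by linarith
  have h4 : (y j : ℝ) < x j + 1 := by linarith
  norm_cast at h3 h4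
  omega

lemma volume_restrict_unitCube {k : ℕ} (x : Fin k → ℤ) :
    (volume : Measure (Fin k → ℝ)).restrict (unitCube x) =
      Measure.pi fun j => volume.restrict (Set.Ioc ((x j : ℝ) - 1 / 2) (x j + 1 / 2)) := by
  rw [unitCube, volume_pi, Measure.restrict_pi_pi]

instance isProbabilityMeasure_restrict_Ioc (a : ℝ) :
    IsProbabilityMeasure (volume.restrict (Set.Ioc (a - 1 / 2) (a + 1 / 2))) :=
  ⟨by rw [Measure.restrict_apply_univ, Real.volume_Ioc]; norm_num⟩

instance isProbabilityMeasure_restrict_unitCube {k : ℕ} (x : Fin k → ℤ) :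
    IsProbabilityMeasure ((volume : Measure (Fin k → ℝ)).restrict (unitCube x)) := by
  rw [volume_restrict_unitCube]
  infer_instance

lemma integrableOn_unitCube {k : ℕ} (x : Fin k → ℤ) {f : (Fin k → ℝ) → ℝ} (hf : Continuous f) :
    IntegrableOn f (unitCube x) :=
  (hf.continuousOn.integrableOn_compact
    (isCompact_univ_pi fun j => isCompact_Icc (a := (x j : ℝ) - 1 / 2) (b := x j + 1 / 2))).mono_set
    (Set.pi_mono fun _ _ => Set.Ioc_subset_Icc_self)

lemma integral_unitCube_dist_sq {k : ℕ} (x : Fin k → ℤ) (c : Fin k → ℝ) :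
    ∫ y in unitCube x, ∑ j, (y j - c j) ^ 2 = ∑ j, ((x j : ℝ) - c j) ^ 2 + k / 12 := by
  rw [integral_finsetSum _ fun j _ => integrableOn_unitCube x (by fun_prop)]
  have h : ∀ j, ∫ y in unitCube x, (y j - c j) ^ 2 = ((x j : ℝ) - c j) ^ 2 + 1 / 12 := by
    intro j
    rw [volume_restrict_unitCube]
    have := (measurePreserving_eval (fun j => (volume : Measure ℝ).restrict
      (Set.Ioc ((x j : ℝ) - 1 / 2) (x j + 1 / 2))) j)
    have h1 := integral_map (μ := Measure.pi (fun j => (volume : Measure ℝ).restrict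
      (Set.Ioc ((x j : ℝ) - 1 / 2) (x j + 1 / 2)))) this.measurable.aemeasurable
      (f := fun t : ℝ => (t - c j) ^ 2) (by fun_prop)
    rw [this.map_eq] at h1
    simp only [Function.eval] at h1
    rw [← h1, ← intervalIntegral.integral_of_le (by linarith),
      intervalIntegral.integral_comp_sub_right (fun t => t ^ 2), integral_pow]
    norm_num
    ring
  rw [sum_congr rfl fun j _ => h j, sum_add_distrib]
  simp
  ring

/-- A set of `N` lattice points has second moment about any centre at least that of a
Euclidean ball of volume `N`, up to the correction `N k / 12` for the unit cubes around the points.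
The function `|y - c|² - R²` is integrated over these cubes and bounded below by
`-(R² - |y - c|²)⁺` on all of `ℝ^k`. -/
lemma second_moment_lower_bound {k : ℕ} (hk : 1 ≤ k) (P : Finset (Fin k → ℤ)) (c : Fin k → ℝ)
    {R : ℝ} (hR : 0 ≤ R) (hvol : unitBallVolume k * R ^ k = (#P : ℝ)) :
    (#P : ℝ) * (k / (k + 2) * R ^ 2 - k / 12) ≤ ∑ x ∈ P, ∑ j, ((x j : ℝ) - c j) ^ 2 := by
  have h1 : ∀ x ∈ P, -(∑ j, ((x j : ℝ) - c j) ^ 2 + k / 12 - R ^ 2) ≤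
      ∫ y in unitCube x, max (R ^ 2 - ∑ j, (y j - c j) ^ 2) 0 := by
    intro x _
    have h2 : ∫ y in unitCube x, (R ^ 2 - ∑ j, (y j - c j) ^ 2) =
        -(∑ j, ((x j : ℝ) - c j) ^ 2 + k / 12 - R ^ 2) := by
      rw [integral_sub (integrableOn_unitCube x (by fun_prop))
        (integrableOn_unitCube x (by fun_prop)), integral_unitCube_dist_sq]
      simp
    rw [← h2]
    exact integral_mono (integrableOn_unitCube x (by fun_prop))
      (integrableOn_unitCube x (by fun_prop)) fun y => le_max_left _ _
  have h3 := sum_le_sum h1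
  rw [← integral_biUnion_finset P (fun x _ => measurableSet_unitCube x)
    (fun x _ y _ hxy => disjoint_unitCube hxy)
    (fun x _ => integrableOn_unitCube x (by fun_prop))] at h3
  have h4 := h3.trans (setIntegral_le_integral (integrable_max_sq_sub_dist_sq c R)
    (Eventually.of_forall fun y => le_max_right _ _))
  rw [integral_max_sq_sub_dist_sq hk c hR, pow_add, ← mul_assoc, hvol, sum_neg_distrib,
    sum_sub_distrib, sum_add_distrib] at h4
  simp only [sum_const, nsmul_eq_mul] at h4
  have h5 : (k : ℝ) / (k + 2) = 1 - 2 / (k + 2) := by field_simp; ring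
  rw [h5]
  linarith

/-! ### The second moment on a slice of the cube -/

/-- The real `m`-th elementary symmetric sum of the weights `a` over `A`. -/
def realEval (m : ℕ) (a : Fin n → ℝ) (A : Finset (Fin n)) : ℝ :=
  ∑ S ∈ A.powersetCard m, ∏ i ∈ S, a i

/-- The mean of `realEval m a` over the subsets of size `s`. -/
noncomputable def sliceMean (m : ℕ) (a : Fin n → ℝ) (s : ℕ) : ℝ :=
  (s.choose m : ℝ) / n.choose m * realEval m a univ

lemma realEval_nonneg {a : Fin n → ℝ} (ha : ∀ i, 0 ≤ a i) (m : ℕ) (A : Finset (Fin n)) :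
    0 ≤ realEval m a A :=
  sum_nonneg fun _ _ => prod_nonneg fun i _ => ha i

lemma prod_le_pow_of_card_eq {a : Fin n → ℝ} {M : ℝ} (ha : ∀ i, 0 ≤ a i) (haM : ∀ i, a i ≤ M)
    {m : ℕ} {S : Finset (Fin n)} (hS : #S = m) : ∏ i ∈ S, a i ≤ M ^ m := by
  rw [← hS, ← prod_const]
  exact prod_le_prod (fun i _ => ha i) fun i _ => haM i

lemma realEval_univ_le {a : Fin n → ℝ} {M : ℝ} (ha : ∀ i, 0 ≤ a i) (haM : ∀ i, a i ≤ M) (m : ℕ) :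
    realEval m a univ ≤ n.choose m * M ^ m := by
  have h := sum_le_card_nsmul ((univ : Finset (Fin n)).powersetCard m) (fun S => ∏ i ∈ S, a i)
    (M ^ m) fun S hS => prod_le_pow_of_card_eq ha haM (mem_powersetCard.1 hS).2
  rwa [card_powersetCard, card_univ, Fintype.card_fin, nsmul_eq_mul] at h

/-- Double counting: a sum over the `s`-sets `A` and the members of a family that lie inside `A`. -/
lemma sum_slice_sum {ι : Type*} (I : Finset ι) (U : ι → Finset (Fin n)) (f : ι → ℝ) {r s : ℕ}
    (hU : ∀ x ∈ I, #(U x) = r) (hrs : r ≤ s) :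
    ∑ A ∈ (univ : Finset (Fin n)).powersetCard s, ∑ x ∈ I with U x ⊆ A, f x =
      (n - r).choose (s - r) * ∑ x ∈ I, f x := by
  simp_rw [sum_filter]
  rw [sum_comm, mul_sum]
  refine sum_congr rfl fun x hx => ?_
  rw [← sum_filter, sum_const, card_filter_powersetCard_subset _ _ _ (subset_univ _)
    (by rw [hU x hx]; exact hrs), hU x hx, card_univ, Fintype.card_fin, nsmul_eq_mul]

lemma powersetCard_eq_filter_univ (m : ℕ) (A : Finset (Fin n)) :
    A.powersetCard m = {S ∈ (univ : Finset (Fin n)).powersetCard m | S ⊆ A} := by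
  ext S
  simp [mem_powersetCard, and_comm]

lemma sum_slice_realEval {m s : ℕ} (a : Fin n → ℝ) (hmn : m ≤ n) :
    ∑ A ∈ (univ : Finset (Fin n)).powersetCard s, realEval m a A =
      n.choose s * sliceMean m a s := by
  by_cases hms : m ≤ s
  · have h := sum_slice_sum ((univ : Finset (Fin n)).powersetCard m) id (fun S => ∏ i ∈ S, a i)
      (fun S hS => (mem_powersetCard.1 hS).2) hms
    simp only [id] at h
    have h0 : ∀ A : Finset (Fin n), realEval m a A =
        ∑ S ∈ (univ : Finset (Fin n)).powersetCard m with S ⊆ A, ∏ i ∈ S, a i := fun A => by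
      rw [realEval, powersetCard_eq_filter_univ]
    rw [sum_congr rfl fun A _ => h0 A, h, sliceMean, realEval]
    have h1 : (n.choose s : ℝ) * s.choose m = n.choose m * (n - m).choose (s - m) := by
      exact_mod_cast Nat.choose_mul hms
    have h2 : (n.choose m : ℝ) ≠ 0 := by exact_mod_cast (Nat.choose_pos hmn).ne'
    rw [← mul_assoc, ← mul_div_assoc, h1, mul_div_cancel_left₀ _ h2]
  · rw [sliceMean, Nat.choose_eq_zero_of_lt (not_le.1 hms)]
    simp only [Nat.cast_zero, zero_div, zero_mul, mul_zero]
    refine sum_eq_zero fun A hA => ?_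
    rw [realEval, powersetCard_eq_empty.2 (by rw [(mem_powersetCard.1 hA).2]; omega), sum_empty]

/-- Negative correlation of disjoint inclusions in a uniform `s`-set, in cleared form. -/
lemma choose_sub_mul_choose_le {m s n : ℕ} (hsn : s ≤ n) (hms : 2 * m ≤ s) :
    (s - m).choose m * n.choose m ≤ (n - m).choose m * s.choose m := by
  have h : (s - m).descFactorial m * n.descFactorial m ≤
      (n - m).descFactorial m * s.descFactorial m := by
    simp only [Nat.descFactorial_eq_prod_range]
    rw [← prod_mul_distrib, ← prod_mul_distrib]
    refine prod_le_prod' fun i hi => ?_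
    rw [mem_range] at hi
    obtain ⟨u, rfl⟩ := Nat.exists_eq_add_of_le hsn
    obtain ⟨v, rfl⟩ := Nat.exists_eq_add_of_le (show m + i ≤ s by omega)
    rw [show m + i + v - m - i = v by omega, show m + i + v + u - i = m + v + u by omega,
      show m + i + v + u - m - i = v + u by omega, show m + i + v - i = m + v by omega]
    nlinarith [Nat.zero_le (m * u)]
  simp only [Nat.descFactorial_eq_factorial_mul_choose] at h
  have := Nat.factorial_pos m
  refine Nat.le_of_mul_le_mul_left ?_ (Nat.mul_pos this this)
  calc _ = _ := by ring
    _ ≤ _ := h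
    _ = _ := by ring

lemma choose_sub_sub_mul_sq_le {m s n : ℕ} (hsn : s ≤ n) (hms : 2 * m ≤ s) :
    (n - 2 * m).choose (s - 2 * m) * n.choose m ^ 2 ≤ n.choose s * s.choose m ^ 2 := by
  have h1 : n.choose s * s.choose (2 * m) = n.choose (2 * m) * (n - 2 * m).choose (s - 2 * m) :=
    Nat.choose_mul hms
  have h2 : s.choose (2 * m) * (2 * m).choose m = s.choose m * (s - m).choose m := by
    rw [Nat.choose_mul (by omega), show 2 * m - m = m by omega]
  have h3 : n.choose (2 * m) * (2 * m).choose m = n.choose m * (n - m).choose m := by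
    rw [Nat.choose_mul (by omega), show 2 * m - m = m by omega]
  have h4 := choose_sub_mul_choose_le hsn hms
  have h5 : 0 < n.choose (2 * m) := Nat.choose_pos (by omega)
  have h6 : 0 < (2 * m).choose m := Nat.choose_pos (by omega)
  refine Nat.le_of_mul_le_mul_left ?_ (Nat.mul_pos h5 h6)
  calc n.choose (2 * m) * (2 * m).choose m *
        ((n - 2 * m).choose (s - 2 * m) * n.choose m ^ 2)
      = (n.choose (2 * m) * (n - 2 * m).choose (s - 2 * m)) * (2 * m).choose m * n.choose m ^ 2 := by
        ring
    _ = n.choose s * (s.choose (2 * m) * (2 * m).choose m) * n.choose m ^ 2 := by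
        rw [← h1]; ring
    _ = n.choose s * s.choose m * n.choose m * ((s - m).choose m * n.choose m) := by
        rw [h2]; ring
    _ ≤ n.choose s * s.choose m * n.choose m * ((n - m).choose m * s.choose m) :=
        Nat.mul_le_mul_left _ h4
    _ = n.choose s * s.choose m ^ 2 * (n.choose m * (n - m).choose m) := by ring
    _ = _ := by rw [← h3]; ring

/-- The pairs of disjoint `m`-sets contribute at most the squared mean. -/
lemma sum_slice_disjoint_pairs_le {m s : ℕ} {a : Fin n → ℝ} (ha : ∀ i, 0 ≤ a i) (hmn : m ≤ n)
    (hsn : s ≤ n) :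
    ∑ A ∈ (univ : Finset (Fin n)).powersetCard s,
      ∑ p ∈ A.powersetCard m ×ˢ A.powersetCard m with Disjoint p.1 p.2,
        (∏ i ∈ p.1, a i) * ∏ i ∈ p.2, a i ≤ n.choose s * sliceMean m a s ^ 2 := by
  have hnn : 0 ≤ n.choose s * sliceMean m a s ^ 2 := by positivity
  by_cases hms : 2 * m ≤ s
  · set I := {p ∈ (univ : Finset (Fin n)).powersetCard m ×ˢ (univ : Finset (Fin n)).powersetCard m |
      Disjoint p.1 p.2} with hI
    have h := sum_slice_sum I (fun p => p.1 ∪ p.2) (fun p => (∏ i ∈ p.1, a i) * ∏ i ∈ p.2, a i)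
      (r := 2 * m) (fun p hp => by
        simp only [hI, mem_filter, mem_product, mem_powersetCard] at hp
        rw [card_union_of_disjoint hp.2, hp.1.1.2, hp.1.2.2]; ring) hms
    have h1 : ∀ A : Finset (Fin n),
        {p ∈ A.powersetCard m ×ˢ A.powersetCard m | Disjoint p.1 p.2} =
          {p ∈ I | p.1 ∪ p.2 ⊆ A} := by
      intro A
      ext p
      simp only [hI, mem_filter, mem_product, mem_powersetCard, subset_univ, true_and,
        union_subset_iff]
      tauto
    simp_rw [h1]
    rw [h]
    have h2 : ∑ p ∈ I, (∏ i ∈ p.1, a i) * ∏ i ∈ p.2, a i ≤ realEval m a univ ^ 2 := by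
      rw [sq, realEval, sum_mul_sum, ← sum_product']
      exact sum_le_sum_of_subset_of_nonneg (filter_subset _ _) fun p _ _ =>
        mul_nonneg (prod_nonneg fun i _ => ha i) (prod_nonneg fun i _ => ha i)
    have h3 : ((n - 2 * m).choose (s - 2 * m) : ℝ) * n.choose m ^ 2 ≤
        n.choose s * s.choose m ^ 2 := by exact_mod_cast choose_sub_sub_mul_sq_le hsn hms
    have h4 : (0 : ℝ) < n.choose m := by exact_mod_cast Nat.choose_pos hmn
    calc _ ≤ ((n - 2 * m).choose (s - 2 * m) : ℝ) * realEval m a univ ^ 2 := by gcongr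
      _ ≤ (n.choose s * s.choose m ^ 2 / n.choose m ^ 2) * realEval m a univ ^ 2 := by
        gcongr
        rw [le_div_iff₀ (by positivity)]
        exact h3
      _ = _ := by rw [sliceMean]; ring
  · refine le_trans (le_of_eq (sum_eq_zero fun A hA => ?_)) hnn
    rw [filter_false_of_mem, sum_empty]
    intro p hp hd
    simp only [mem_product, mem_powersetCard] at hp hA
    have := card_le_card (union_subset hp.1.1 hp.2.1)
    rw [card_union_of_disjoint hd] at this
    omega

/-- A pair of intersecting `m`-subsets of `A` is determined by a common element and the two
remainders. -/
lemma card_intersecting_pairs_le {α : Type*} [DecidableEq α] (m : ℕ) (hm : 1 ≤ m) (A : Finset α) :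
    #{p ∈ A.powersetCard m ×ˢ A.powersetCard m | ¬ Disjoint p.1 p.2} ≤
      #A * (#A - 1).choose (m - 1) ^ 2 := by
  have h : {p ∈ A.powersetCard m ×ˢ A.powersetCard m | ¬ Disjoint p.1 p.2} ⊆
      A.biUnion fun i => {S ∈ A.powersetCard m | {i} ⊆ S} ×ˢ {S ∈ A.powersetCard m | {i} ⊆ S} := by
    intro p hp
    simp only [mem_filter, mem_product, not_disjoint_iff] at hp
    obtain ⟨⟨h1, h2⟩, i, hi1, hi2⟩ := hp
    simp only [mem_biUnion, mem_product, mem_filter, singleton_subset_iff]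
    exact ⟨i, (mem_powersetCard.1 h1).1 hi1, ⟨h1, hi1⟩, h2, hi2⟩
  refine (card_le_card h).trans (card_biUnion_le_card_mul _ _ _ fun i hi => ?_)
  rw [card_product, card_filter_powersetCard_subset _ _ _ (singleton_subset_iff.2 hi)
    (by simpa using hm), card_singleton, sq]

lemma choose_pred_le (s m : ℕ) :
    ((s - 1).choose (m - 1) : ℝ) ≤ (s : ℝ) ^ (m - 1) / (m - 1).factorial := by
  refine (Nat.choose_le_pow_div (α := ℝ) _ _).trans ?_
  gcongr
  omega

lemma sum_intersecting_pairs_le {m : ℕ} (hm : 1 ≤ m) {a : Fin n → ℝ} {M : ℝ} (ha : ∀ i, 0 ≤ a i)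
    (haM : ∀ i, a i ≤ M) (hM : 0 ≤ M) (A : Finset (Fin n)) :
    ∑ p ∈ A.powersetCard m ×ˢ A.powersetCard m with ¬ Disjoint p.1 p.2,
        (∏ i ∈ p.1, a i) * ∏ i ∈ p.2, a i ≤
      M ^ (2 * m) * (#A : ℝ) ^ (2 * m - 1) / ((m - 1).factorial : ℝ) ^ 2 := by
  have h : ∀ p ∈ {p ∈ A.powersetCard m ×ˢ A.powersetCard m | ¬ Disjoint p.1 p.2},
      (∏ i ∈ p.1, a i) * ∏ i ∈ p.2, a i ≤ M ^ (2 * m) := by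
    intro p hp
    simp only [mem_filter, mem_product, mem_powersetCard] at hp
    rw [two_mul, pow_add]
    exact mul_le_mul (prod_le_pow_of_card_eq ha haM hp.1.1.2)
      (prod_le_pow_of_card_eq ha haM hp.1.2.2) (prod_nonneg fun i _ => ha i) (by positivity)
  refine (sum_le_card_nsmul _ _ _ h).trans ?_
  rw [nsmul_eq_mul]
  have h2 : (#{p ∈ A.powersetCard m ×ˢ A.powersetCard m | ¬ Disjoint p.1 p.2} : ℝ) ≤
      #A * ((#A - 1).choose (m - 1) : ℝ) ^ 2 := by
    exact_mod_cast card_intersecting_pairs_le m hm A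
  calc _ ≤ (#A * ((#A : ℝ) ^ (m - 1) / (m - 1).factorial) ^ 2) * M ^ (2 * m) := by
        gcongr
        refine h2.trans ?_
        gcongr
        exact choose_pred_le _ _
    _ = _ := by
        obtain ⟨l, rfl⟩ := Nat.exists_eq_add_of_le' hm
        rw [Nat.add_sub_cancel, show 2 * (l + 1) - 1 = 1 + l * 2 by omega, pow_add, pow_mul]
        ring

lemma realEval_sq (m : ℕ) (a : Fin n → ℝ) (A : Finset (Fin n)) :
    realEval m a A ^ 2 =
      (∑ p ∈ A.powersetCard m ×ˢ A.powersetCard m with Disjoint p.1 p.2,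
        (∏ i ∈ p.1, a i) * ∏ i ∈ p.2, a i) +
      ∑ p ∈ A.powersetCard m ×ˢ A.powersetCard m with ¬ Disjoint p.1 p.2,
        (∏ i ∈ p.1, a i) * ∏ i ∈ p.2, a i := by
  rw [sum_filter_add_sum_filter_not, sq, realEval, sum_mul_sum, ← sum_product']

/-- The second moment of `realEval m a` about `c` on the sets of size `s`: the variance on the slice
comes from intersecting pairs only, because disjoint ones are negatively correlated. -/
lemma sum_slice_sq_le {m s : ℕ} (hm : 1 ≤ m) {a : Fin n → ℝ} {M : ℝ} (ha : ∀ i, 0 ≤ a i)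
    (haM : ∀ i, a i ≤ M) (hM : 0 ≤ M) (hmn : m ≤ n) (hsn : s ≤ n) (c : ℝ) :
    ∑ A ∈ (univ : Finset (Fin n)).powersetCard s, (realEval m a A - c) ^ 2 ≤
      n.choose s * (M ^ (2 * m) * (s : ℝ) ^ (2 * m - 1) / ((m - 1).factorial : ℝ) ^ 2 +
        (sliceMean m a s - c) ^ 2) := by
  have h1 : ∑ A ∈ (univ : Finset (Fin n)).powersetCard s, realEval m a A ^ 2 ≤
      n.choose s * sliceMean m a s ^ 2 +
        n.choose s * (M ^ (2 * m) * (s : ℝ) ^ (2 * m - 1) / ((m - 1).factorial : ℝ) ^ 2) := by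
    simp_rw [realEval_sq]
    rw [sum_add_distrib]
    refine add_le_add (sum_slice_disjoint_pairs_le ha hmn hsn) ?_
    refine (sum_le_card_nsmul _ _
      (M ^ (2 * m) * (s : ℝ) ^ (2 * m - 1) / ((m - 1).factorial : ℝ) ^ 2) fun A hA => ?_).trans_eq ?_
    · have := sum_intersecting_pairs_le hm ha haM hM A
      rwa [(mem_powersetCard.1 hA).2] at this
    · simp
  have h2 : ∑ A ∈ (univ : Finset (Fin n)).powersetCard s, (realEval m a A - c) ^ 2 =
      ∑ A ∈ (univ : Finset (Fin n)).powersetCard s, realEval m a A ^ 2 -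
        2 * c * ∑ A ∈ (univ : Finset (Fin n)).powersetCard s, realEval m a A +
          n.choose s * c ^ 2 := by
    rw [mul_sum, ← sum_sub_distrib]
    have : (n.choose s * c ^ 2 : ℝ) = ∑ A ∈ (univ : Finset (Fin n)).powersetCard s, c ^ 2 := by simp
    rw [this, ← sum_add_distrib]
    exact sum_congr rfl fun A _ => by ring
  rw [h2, sum_slice_realEval a hmn]
  linarith

lemma choose_sub_choose_le {m : ℕ} {t s : ℕ} (hm : 1 ≤ m) (hts : t ≤ s) :
    (s.choose m : ℝ) - t.choose m ≤ (s - t) * (s - 1).choose (m - 1) := by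
  obtain ⟨l, rfl⟩ := Nat.exists_eq_add_of_le' hm
  induction s, hts using Nat.le_induction with
  | base => simp
  | succ s hs ih =>
    have h1 : ((s - 1).choose (l + 1 - 1) : ℝ) ≤ s.choose l := by
      exact_mod_cast Nat.choose_le_choose _ (by omega)
    have h2 : (t : ℝ) ≤ s := by exact_mod_cast hs
    have h3 : ((s : ℝ) - t) * (s - 1).choose (l + 1 - 1) ≤ (s - t) * s.choose l :=
      mul_le_mul_of_nonneg_left h1 (by linarith)
    rw [Nat.choose_succ_succ]
    simp only [Nat.add_sub_cancel] at *
    push_cast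
    linarith

lemma sliceMean_sub_sq_le {m : ℕ} (hm : 1 ≤ m) {a : Fin n → ℝ} {M L : ℝ} (ha : ∀ i, 0 ≤ a i)
    (haM : ∀ i, a i ≤ M) (hM : 0 ≤ M) (hmn : m ≤ n) {s t : ℕ} (hs : (s : ℝ) ≤ L)
    (ht : (t : ℝ) ≤ L) :
    (sliceMean m a s - sliceMean m a t) ^ 2 ≤
      M ^ (2 * m) * L ^ (2 * m - 2) / ((m - 1).factorial : ℝ) ^ 2 * ((s : ℝ) - t) ^ 2 := by
  wlog hts : t ≤ s generalizing s t
  · rw [sub_sq_comm, sub_sq_comm (s : ℝ)]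
    exact this ht hs (by omega)
  have h4 : (0 : ℝ) < n.choose m := by exact_mod_cast Nat.choose_pos hmn
  have h1 : 0 ≤ realEval m a univ / n.choose m :=
    div_nonneg (realEval_nonneg ha _ _) h4.le
  have h2 : realEval m a univ / n.choose m ≤ M ^ m := by
    rw [div_le_iff₀ h4, mul_comm]
    exact realEval_univ_le ha haM m
  have h5 : (t.choose m : ℝ) ≤ s.choose m := by exact_mod_cast Nat.choose_le_choose m hts
  have h6 : (t : ℝ) ≤ s := by exact_mod_cast hts
  have h3 : (s.choose m : ℝ) - t.choose m ≤ (s - t) * (L ^ (m - 1) / (m - 1).factorial) := by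
    refine (choose_sub_choose_le hm hts).trans (mul_le_mul_of_nonneg_left ?_ (by linarith))
    refine (choose_pred_le s m).trans ?_
    gcongr
  have h7 : sliceMean m a s - sliceMean m a t =
      realEval m a univ / n.choose m * ((s.choose m : ℝ) - t.choose m) := by
    rw [sliceMean, sliceMean]; ring
  have h8 : sliceMean m a s - sliceMean m a t ≤
      M ^ m * ((s - t) * (L ^ (m - 1) / (m - 1).factorial)) := by
    rw [h7]
    exact mul_le_mul h2 h3 (by linarith) (by positivity)
  have h9 : 0 ≤ sliceMean m a s - sliceMean m a t := by
    rw [h7]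
    exact mul_nonneg h1 (by linarith)
  refine (pow_le_pow_left₀ h9 h8 2).trans_eq ?_
  rw [show 2 * m - 2 = (m - 1) * 2 by omega, pow_mul', pow_mul]
  ring

/-! ### The second moment over the small sets -/

lemma mem_smallSets {lam : ℝ} {A : Finset (Fin n)} :
    A ∈ smallSets lam n ↔ (#A : ℝ) ≤ lam * n := by
  simp [smallSets]

lemma sum_smallSets {lam : ℝ} (hlam : 0 ≤ lam) (f : Finset (Fin n) → ℝ) :
    ∑ A ∈ smallSets lam n, f A =
      ∑ s ∈ range (⌊lam * n⌋₊ + 1), ∑ A ∈ (univ : Finset (Fin n)).powersetCard s, f A := by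
  have h0 : 0 ≤ lam * n := by positivity
  rw [← sum_fiberwise_of_maps_to (g := card) (t := range (⌊lam * n⌋₊ + 1)) (fun A hA => by
    rw [mem_range, Nat.lt_succ_iff, Nat.le_floor_iff h0]; exact mem_smallSets.1 hA)]
  refine sum_congr rfl fun s hs => sum_congr ?_ fun _ _ => rfl
  rw [mem_range, Nat.lt_succ_iff, Nat.le_floor_iff h0] at hs
  ext A
  simp only [mem_filter, mem_smallSets, mem_powersetCard, subset_univ, true_and]
  exact ⟨fun h => h.2, fun h => ⟨h ▸ hs, h⟩⟩

lemma choose_le_card_smallSets {lam : ℝ} {s : ℕ} (hs : (s : ℝ) ≤ lam * n) :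
    n.choose s ≤ #(smallSets lam n) := by
  have h : (univ : Finset (Fin n)).powersetCard s ⊆ smallSets lam n := fun A hA =>
    mem_smallSets.2 (by rwa [(mem_powersetCard.1 hA).2])
  simpa using card_le_card h

/-- The second moment over the small sets, split into the contribution of the slices and that of the
varying size. -/
lemma sum_smallSets_sq_le {lam : ℝ} (hlam0 : 0 ≤ lam) (hlam1 : lam ≤ 1) {m : ℕ} (hm : 1 ≤ m)
    {a : Fin n → ℝ} {M : ℝ} (ha : ∀ i, 0 ≤ a i) (haM : ∀ i, a i ≤ M) (hM : 0 ≤ M) (hmn : m ≤ n)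
    {s₀ : ℕ} (hs₀ : (s₀ : ℝ) ≤ lam * n) :
    ∑ A ∈ smallSets lam n, (realEval m a A - sliceMean m a s₀) ^ 2 ≤
      M ^ (2 * m) * (lam * n) ^ (2 * m - 2) / ((m - 1).factorial : ℝ) ^ 2 *
        (lam * n * #(smallSets lam n) + ∑ A ∈ smallSets lam n, ((#A : ℝ) - s₀) ^ 2) := by
  have h0 : 0 ≤ lam * n := by positivity
  have h1 : ((#(smallSets lam n) : ℕ) : ℝ) = ∑ A ∈ smallSets lam n, (1 : ℝ) := by simp
  rw [h1, mul_sum, ← sum_add_distrib, mul_sum, sum_smallSets hlam0, sum_smallSets hlam0]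
  refine sum_le_sum fun s hs => ?_
  rw [mem_range, Nat.lt_succ_iff, Nat.le_floor_iff h0] at hs
  have hsn : s ≤ n := by
    have : (s : ℝ) ≤ n := hs.trans (mul_le_of_le_one_left (by positivity) hlam1)
    exact_mod_cast this
  refine (sum_slice_sq_le hm ha haM hM hmn hsn _).trans ?_
  rw [sum_congr rfl fun A hA => by rw [(mem_powersetCard.1 hA).2]]
  rw [sum_const, card_powersetCard, card_univ, Fintype.card_fin, nsmul_eq_mul]
  refine mul_le_mul_of_nonneg_left ?_ (by positivity)
  rw [mul_one, mul_add]
  refine add_le_add ?_ (sliceMean_sub_sq_le hm ha haM hM hmn hs hs₀)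
  calc M ^ (2 * m) * (s : ℝ) ^ (2 * m - 1) / ((m - 1).factorial : ℝ) ^ 2
      ≤ M ^ (2 * m) * (lam * n) ^ (2 * m - 1) / ((m - 1).factorial : ℝ) ^ 2 := by gcongr
    _ = _ := by
      rw [show 2 * m - 1 = (2 * m - 2) + 1 by omega, pow_succ]
      ring

/-! ### The distribution of the size of a small set -/

/-- The second moment of `2 |A| - |s|` over all subsets `A` of `s`, about `-d`. The shift `d` serves
to centre the size at the integer part of `|s| / 2`. -/
lemma sum_powerset_two_mul_card_sq {α : Type*} [DecidableEq α] (s : Finset α) (d : ℝ) :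
    ∑ A ∈ s.powerset, (2 * (#A : ℝ) - #s + d) ^ 2 = 2 ^ #s * (#s + d ^ 2) := by
  induction s using Finset.induction_on with
  | empty => simp
  | insert x s hx ih =>
    rw [sum_powerset_insert hx, ← sum_add_distrib, card_insert_of_notMem hx]
    have h : ∀ A ∈ s.powerset, (2 * (#A : ℝ) - ((#s + 1 : ℕ) : ℝ) + d) ^ 2 +
        (2 * (#(insert x A) : ℝ) - ((#s + 1 : ℕ) : ℝ) + d) ^ 2 =
          2 * (2 * (#A : ℝ) - #s + d) ^ 2 + 2 := by
      intro A hA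
      rw [card_insert_of_notMem fun h => hx (mem_powerset.1 hA h)]
      push_cast
      ring
    rw [sum_congr rfl h, sum_add_distrib, ← mul_sum, ih, sum_const, card_powerset, nsmul_eq_mul]
    push_cast
    ring

/-- For `1 / 2 ≤ lam`, at least one of a set and its complement is small. -/
lemma two_pow_le_card_smallSets {lam : ℝ} (hlam : 1 / 2 ≤ lam) (n : ℕ) :
    2 ^ n ≤ 2 * #(smallSets lam n) := by
  have h : (univ : Finset (Finset (Fin n))) ⊆
      smallSets lam n ∪ (smallSets lam n).image compl := by
    intro A _
    rw [mem_union, mem_image]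
    by_cases hA : A ∈ smallSets lam n
    · exact Or.inl hA
    · refine Or.inr ⟨Aᶜ, ?_, compl_compl A⟩
      rw [mem_smallSets, not_le] at hA
      have h1 : (#A : ℝ) + #Aᶜ = n := by exact_mod_cast (card_add_card_compl A).trans (by simp)
      have h2 : (0 : ℝ) ≤ n := by positivity
      rw [mem_smallSets]
      nlinarith
  have h1 := (card_le_card h).trans (card_union_le _ _)
  have h2 := card_image_le (s := smallSets lam n) (f := compl)
  simp only [card_univ, Fintype.card_finset, Fintype.card_fin] at h1
  omega

lemma sum_size_sq_le_of_half_le {lam : ℝ} (hlam : 1 / 2 ≤ lam) (hn : 1 ≤ n) :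
    ∑ A ∈ smallSets lam n, ((#A : ℝ) - (n / 2 : ℕ)) ^ 2 ≤
      (1 + 2 * lam) * lam * n * #(smallSets lam n) := by
  have h1 : ∑ A ∈ smallSets lam n, ((#A : ℝ) - (n / 2 : ℕ)) ^ 2 ≤
      ∑ A ∈ (univ : Finset (Fin n)).powerset, ((#A : ℝ) - (n / 2 : ℕ)) ^ 2 :=
    sum_le_sum_of_subset_of_nonneg (fun A _ => by simp) fun _ _ _ => sq_nonneg _
  have h2 := sum_powerset_two_mul_card_sq (univ : Finset (Fin n)) ((n % 2 : ℕ) : ℝ)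
  have h3 : (n : ℝ) = 2 * (n / 2 : ℕ) + (n % 2 : ℕ) := by exact_mod_cast (Nat.div_add_mod n 2).symm
  have h4 : ∀ A : Finset (Fin n), (2 * (#A : ℝ) - n + (n % 2 : ℕ)) ^ 2 =
      4 * ((#A : ℝ) - (n / 2 : ℕ)) ^ 2 := by
    intro A
    rw [show 2 * (#A : ℝ) - n + (n % 2 : ℕ) = 2 * ((#A : ℝ) - (n / 2 : ℕ)) by linarith]
    ring
  simp only [card_univ, Fintype.card_fin, h4, ← mul_sum] at h2
  have h5 : (2 : ℝ) ^ n ≤ 2 * #(smallSets lam n) := by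
    exact_mod_cast two_pow_le_card_smallSets hlam n
  have h6 : ((n % 2 : ℕ) : ℝ) ^ 2 ≤ 1 := by
    have : ((n % 2 : ℕ) : ℝ) ≤ 1 := by exact_mod_cast (by omega : n % 2 ≤ 1)
    exact pow_le_one₀ (by positivity) this
  have h7 : (1 : ℝ) ≤ n := by exact_mod_cast hn
  have h8 : (2 : ℝ) ^ n * (n + ((n % 2 : ℕ) : ℝ) ^ 2) ≤ (2 * #(smallSets lam n)) * (2 * n) := by
    gcongr
    linarith
  have h9 : 1 * (n * (#(smallSets lam n) : ℝ)) ≤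
      (1 + 2 * lam) * lam * (n * #(smallSets lam n)) := by
    gcongr
    nlinarith
  linarith

/-- Below `lam n`, with `lam < 1 / 2`, consecutive binomial coefficients have ratio at most
`lam / (1 - lam)`. -/
lemma choose_sub_le_geometric {lam : ℝ} (hlam0 : 0 < lam) (hlam1 : lam < 1 / 2) {s : ℕ}
    (hs : (s : ℝ) ≤ lam * n) {j : ℕ} (hj : j ≤ s) :
    (n.choose (s - j) : ℝ) ≤ (lam / (1 - lam)) ^ j * n.choose s := by
  induction j with
  | zero => simp
  | succ j ih =>
    obtain ⟨u, hu⟩ : ∃ u, s - j = u + 1 := ⟨s - j - 1, by omega⟩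
    have h1 := ih (by omega)
    rw [hu] at h1
    have hus : ((u + 1 : ℕ) : ℝ) ≤ lam * n :=
      le_trans (by exact_mod_cast (by omega : u + 1 ≤ s)) hs
    have hn0 : (0 : ℝ) < n := by
      by_contra h
      have h' : (0 : ℝ) < (u + 1 : ℕ) := by positivity
      nlinarith
    have hun : u ≤ n := by
      have : ((u + 1 : ℕ) : ℝ) ≤ n := hus.trans (by nlinarith)
      have : u + 1 ≤ n := by exact_mod_cast this
      omega
    have h2 : (n.choose (u + 1) : ℝ) * (u + 1 : ℕ) = n.choose u * (n - u) := by
      rw [← Nat.cast_sub hun]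
      exact_mod_cast Nat.choose_succ_right_eq n u
    have h3 : (n.choose u : ℝ) * (1 - lam) ≤ n.choose (u + 1) * lam := by
      refine le_of_mul_le_mul_right ?_ hn0
      calc (n.choose u : ℝ) * (1 - lam) * n = n.choose u * (n - lam * n) := by ring
        _ ≤ n.choose u * (n - u) := by
          gcongr
          push_cast at hus
          linarith
        _ = n.choose (u + 1) * (u + 1 : ℕ) := h2.symm
        _ ≤ n.choose (u + 1) * (lam * n) := by gcongr
        _ = _ := by ring
    have h4 : (n.choose u : ℝ) ≤ lam / (1 - lam) * n.choose (u + 1) := by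
      rw [div_mul_eq_mul_div, le_div_iff₀ (by linarith)]
      linarith
    have h0 : 0 ≤ lam / (1 - lam) := div_nonneg hlam0.le (by linarith)
    rw [show s - (j + 1) = u by omega, pow_succ', mul_assoc]
    exact h4.trans (mul_le_mul_of_nonneg_left h1 h0)

lemma exists_sum_size_sq_le_of_lt_half {lam : ℝ} (hlam0 : 0 < lam) (hlam1 : lam < 1 / 2) :
    ∃ K : ℝ, ∀ n : ℕ, ∑ A ∈ smallSets lam n, ((#A : ℝ) - ⌊lam * n⌋₊) ^ 2 ≤
      K * #(smallSets lam n) := by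
  set r := lam / (1 - lam) with hr
  have hr0 : 0 ≤ r := div_nonneg hlam0.le (by linarith)
  have hr1 : r < 1 := by rw [hr, div_lt_one (by linarith)]; linarith
  have hsum : Summable fun j : ℕ => (j : ℝ) ^ 2 * r ^ j :=
    summable_pow_mul_geometric_of_norm_lt_one 2 (by rwa [Real.norm_of_nonneg hr0])
  refine ⟨∑' j : ℕ, (j : ℝ) ^ 2 * r ^ j, fun n => ?_⟩
  have h0 : 0 ≤ lam * n := by positivity
  have hs : ((⌊lam * n⌋₊ : ℕ) : ℝ) ≤ lam * n := Nat.floor_le h0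
  set s₀ := ⌊lam * n⌋₊ with hs₀
  rw [sum_smallSets hlam0.le, ← hs₀]
  have h1 : ∀ s ∈ range (s₀ + 1), ∑ A ∈ (univ : Finset (Fin n)).powersetCard s,
      ((#A : ℝ) - s₀) ^ 2 = n.choose s * ((s : ℝ) - s₀) ^ 2 := by
    intro s _
    rw [sum_congr rfl fun A hA => by rw [(mem_powersetCard.1 hA).2]]
    simp
  rw [sum_congr rfl h1, ← sum_range_reflect]
  have h2 : ∀ j ∈ range (s₀ + 1), (n.choose (s₀ + 1 - 1 - j) : ℝ) *
      (((s₀ + 1 - 1 - j : ℕ) : ℝ) - s₀) ^ 2 ≤ n.choose s₀ * ((j : ℝ) ^ 2 * r ^ j) := by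
    intro j hj
    have hj' : j ≤ s₀ := by rw [mem_range] at hj; omega
    rw [Nat.add_sub_cancel, Nat.cast_sub hj']
    have := choose_sub_le_geometric hlam0 hlam1 hs hj'
    calc _ = (n.choose (s₀ - j) : ℝ) * (j : ℝ) ^ 2 := by ring
      _ ≤ (r ^ j * n.choose s₀) * (j : ℝ) ^ 2 := by gcongr
      _ = _ := by ring
  refine (sum_le_sum h2).trans ?_
  rw [← mul_sum, mul_comm]
  have h3 : (n.choose s₀ : ℝ) ≤ #(smallSets lam n) := by
    exact_mod_cast choose_le_card_smallSets hs
  exact mul_le_mul (hsum.sum_le_tsum _ fun j _ => by positivity) h3 (by positivity)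
    (tsum_nonneg fun j => by positivity)

/-- The size of a small set has second moment at most `(1 + 2 lam) lam n` about a suitable centre:
the integer part of `n / 2` when `1 / 2 ≤ lam`, and of `lam n` when `lam < 1 / 2`, where the second moment is even
bounded. -/
lemma eventually_exists_sum_size_sq_le {lam : ℝ} (hlam0 : 0 < lam) :
    ∀ᶠ n : ℕ in atTop, ∃ s₀ : ℕ, (s₀ : ℝ) ≤ lam * n ∧
      ∑ A ∈ smallSets lam n, ((#A : ℝ) - s₀) ^ 2 ≤
        (1 + 2 * lam) * lam * n * #(smallSets lam n) := by
  rcases lt_or_ge lam (1 / 2) with hlam | hlam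
  · obtain ⟨K, hK⟩ := exists_sum_size_sq_le_of_lt_half hlam0 hlam
    have ht : Tendsto (fun n : ℕ => (1 + 2 * lam) * lam * (n : ℝ)) atTop atTop :=
      tendsto_natCast_atTop_atTop.const_mul_atTop (by positivity)
    filter_upwards [ht.eventually_ge_atTop K] with n hn
    exact ⟨⌊lam * n⌋₊, Nat.floor_le (by positivity), (hK n).trans (by gcongr)⟩
  · filter_upwards [eventually_ge_atTop 1] with n hn
    refine ⟨n / 2, ?_, sum_size_sq_le_of_half_le hlam hn⟩
    have h1 : ((n / 2 : ℕ) : ℝ) ≤ n / 2 := Nat.cast_div_le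
    have h2 : (0 : ℝ) ≤ n := by positivity
    nlinarith

/-! ### Sets with fewer than `m` elements are negligible -/

lemma card_smallSets_lt_mul_le {lam : ℝ} {m : ℕ} (hm : 1 ≤ m) (hmn : 2 * m ≤ n)
    (hlam : (m : ℝ) ≤ lam * n) :
    #{A ∈ smallSets lam n | ¬ m ≤ #A} * (n - m) ≤ m ^ 2 * #(smallSets lam n) := by
  have h1 : {A ∈ smallSets lam n | ¬ m ≤ #A} ⊆
      (range m).biUnion fun s => (univ : Finset (Fin n)).powersetCard s := by
    intro A hA
    simp only [mem_filter, not_le] at hA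
    simp [mem_biUnion, mem_powersetCard, hA.2]
  have h2 : ∀ j, j ≤ m - 1 → n.choose (m - 1 - j) ≤ n.choose (m - 1) := by
    intro j
    induction j with
    | zero => simp
    | succ j ih =>
      intro hj
      have := Nat.choose_le_succ_of_lt_half_left (r := m - 1 - (j + 1)) (n := n) (by omega)
      rw [show m - 1 - (j + 1) + 1 = m - 1 - j by omega] at this
      exact this.trans (ih (by omega))
  have h3 : #{A ∈ smallSets lam n | ¬ m ≤ #A} ≤ m * n.choose (m - 1) := by
    refine (card_le_card h1).trans ((card_biUnion_le_card_mul _ _ (n.choose (m - 1)) ?_).trans ?_)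
    · intro s hs
      rw [mem_range] at hs
      have := h2 (m - 1 - s) (by omega)
      rw [show m - 1 - (m - 1 - s) = s by omega] at this
      simpa using this
    · simp
  have h4 : n.choose m * m = n.choose (m - 1) * (n - (m - 1)) := by
    have := Nat.choose_succ_right_eq n (m - 1)
    rwa [show m - 1 + 1 = m by omega] at this
  calc _ ≤ m * n.choose (m - 1) * (n - (m - 1)) := Nat.mul_le_mul h3 (by omega)
    _ = m ^ 2 * n.choose m := by rw [mul_assoc, ← h4]; ring
    _ ≤ _ := Nat.mul_le_mul_left _ (choose_le_card_smallSets hlam)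

/-! ### Comparison of the two estimates -/

/-- The number of small sets of size at least `m`. -/
noncomputable def numLarge (lam : ℝ) (m n : ℕ) : ℕ := #{A ∈ smallSets lam n | m ≤ #A}

lemma one_le_card_smallSets {lam : ℝ} (hlam0 : 0 ≤ lam) (n : ℕ) : 1 ≤ #(smallSets lam n) := by
  have : 0 ≤ lam * n := by positivity
  simpa using choose_le_card_smallSets (lam := lam) (n := n) (s := 0) (by simpa using this)

lemma tendsto_card_smallSets {lam : ℝ} (hlam0 : 0 < lam) :
    Tendsto (fun n : ℕ => (#(smallSets lam n) : ℝ)) atTop atTop := by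
  have ht : Tendsto (fun n : ℕ => lam * (n : ℝ)) atTop atTop :=
    tendsto_natCast_atTop_atTop.const_mul_atTop hlam0
  refine tendsto_atTop_mono' _ ?_ tendsto_natCast_atTop_atTop
  filter_upwards [ht.eventually_ge_atTop 1] with n hn
  have := choose_le_card_smallSets (lam := lam) (n := n) (s := 1) (by simpa using hn)
  rw [Nat.choose_one_right] at this
  exact_mod_cast this

lemma tendsto_numLarge_div {lam : ℝ} (hlam0 : 0 < lam) {m : ℕ} (hm : 1 ≤ m) :
    Tendsto (fun n : ℕ => (numLarge lam m n : ℝ) / #(smallSets lam n)) atTop (nhds 1) := by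
  have ht : Tendsto (fun n : ℕ => lam * (n : ℝ)) atTop atTop :=
    tendsto_natCast_atTop_atTop.const_mul_atTop hlam0
  have h1 : Tendsto (fun n : ℕ => 1 - (m : ℝ) ^ 2 / ((n : ℝ) - m)) atTop (nhds 1) := by
    have : Tendsto (fun n : ℕ => (m : ℝ) ^ 2 / ((n : ℝ) - m)) atTop (nhds 0) :=
      (tendsto_atTop_add_const_right _ (-(m : ℝ)) tendsto_natCast_atTop_atTop).const_div_atTop _
    simpa using this.const_sub 1
  refine tendsto_of_tendsto_of_tendsto_of_le_of_le' h1 tendsto_const_nhds ?_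
    (Eventually.of_forall fun n => ?_)
  · filter_upwards [ht.eventually_ge_atTop m, eventually_ge_atTop (2 * m)] with n hn hmn
    have h2 := card_smallSets_lt_mul_le hm hmn hn
    have h3 := card_filter_add_card_filter_not (s := smallSets lam n) (fun A => m ≤ #A)
    have hN : (0 : ℝ) < #(smallSets lam n) := by
      exact_mod_cast one_le_card_smallSets hlam0.le n
    have hnm : (0 : ℝ) < (n : ℝ) - m := by
      rw [sub_pos]
      exact_mod_cast (by omega : m < n)
    have h4 : (#{A ∈ smallSets lam n | ¬ m ≤ #A} : ℝ) * (n - m) ≤ m ^ 2 * #(smallSets lam n) := by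
      rw [← Nat.cast_sub (by omega)]
      exact_mod_cast h2
    have h5 : (numLarge lam m n : ℝ) + #{A ∈ smallSets lam n | ¬ m ≤ #A} =
        #(smallSets lam n) := by exact_mod_cast h3
    have h6 : (#{A ∈ smallSets lam n | ¬ m ≤ #A} : ℝ) / #(smallSets lam n) ≤
        (m : ℝ) ^ 2 / ((n : ℝ) - m) := by
      rw [div_le_div_iff₀ hN hnm]
      exact h4
    rw [← h5] at h6 hN ⊢
    have h7 : (numLarge lam m n : ℝ) / (numLarge lam m n + #{A ∈ smallSets lam n | ¬ m ≤ #A}) =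
      1 - #{A ∈ smallSets lam n | ¬ m ≤ #A} /
        (numLarge lam m n + #{A ∈ smallSets lam n | ¬ m ≤ #A}) := by
      rw [eq_sub_iff_add_eq, ← add_div, div_self hN.ne']
    linarith
  · refine div_le_one_of_le₀ ?_ (by positivity)
    exact_mod_cast card_le_card (filter_subset _ _)

/-- The error factor `1 + ε n` of the lower bound: it accounts for the sets with fewer than `m`
elements and for the unit cubes around the lattice points. -/
noncomputable def errorFactor (k m : ℕ) (lam : ℝ) (n : ℕ) : ℝ :=
  (numLarge lam m n : ℝ) / #(smallSets lam n) *
    (((numLarge lam m n : ℝ) / #(smallSets lam n)) ^ ((2 : ℝ) / k) -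
      Real.pi * (k + 2) / (12 * Real.Gamma ((k : ℝ) / 2 + 1) ^ ((2 : ℝ) / k)) *
        (#(smallSets lam n) : ℝ) ^ (-((2 : ℝ) / k)))

lemma tendsto_errorFactor {k m : ℕ} {lam : ℝ} (hk : 1 ≤ k) (hm : 1 ≤ m) (hlam0 : 0 < lam) :
    Tendsto (errorFactor k m lam) atTop (nhds 1) := by
  have hk' : (0 : ℝ) < k := by exact_mod_cast hk
  have h1 := tendsto_numLarge_div hlam0 hm
  have h2 := h1.rpow_const (p := (2 : ℝ) / k) (Or.inl one_ne_zero)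
  have h3 := ((tendsto_rpow_neg_atTop (y := (2 : ℝ) / k) (by positivity)).comp
    (tendsto_card_smallSets hlam0)).const_mul
    (Real.pi * (k + 2) / (12 * Real.Gamma ((k : ℝ) / 2 + 1) ^ ((2 : ℝ) / k)))
  have h4 : Tendsto (errorFactor k m lam) atTop _ := h1.mul (h2.sub h3)
  simpa using h4

/-- The constant `boundConst` is at most the one of the case `lam < 1 / 2`. -/
lemma boundConst_le {k m : ℕ} {lam : ℝ} (hm : 1 ≤ m) (hlam0 : 0 < lam) :
    boundConst k m lam ≤
      (((m - 1).factorial : ℝ) ^ 2 * Real.Gamma ((k : ℝ) / 2 + 1) ^ ((2 : ℝ) / k)) /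
        (2 * (lam ^ (2 * m - 1) + lam ^ (2 * m)) * Real.pi * ((k : ℝ) + 2)) := by
  have hG : 0 < Real.Gamma ((k : ℝ) / 2 + 1) ^ ((2 : ℝ) / k) :=
    Real.rpow_pos_of_pos (Real.Gamma_pos_of_pos (by positivity)) _
  have hpi := Real.pi_pos
  set G := Real.Gamma ((k : ℝ) / 2 + 1) ^ ((2 : ℝ) / k)
  have hfac : ((m.factorial : ℕ) : ℝ) = m * (m - 1).factorial := by
    exact_mod_cast (Nat.mul_factorial_pred (by omega)).symm
  have hm0 : (0 : ℝ) < m := by exact_mod_cast hm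
  have hf0 : (0 : ℝ) < (m - 1).factorial := by exact_mod_cast Nat.factorial_pos _
  set f : ℝ := ((m - 1).factorial : ℝ)
  set u := lam ^ (2 * m - 1)
  set v := lam ^ (2 * m)
  have hu : 0 < u := by positivity
  have hv : 0 < v := by positivity
  have hkey : ∀ q : ℝ, 0 < q → (q * f ^ 2 * G) / ((2 * q * u + 2 * q * v + 1) * Real.pi * (k + 2)) ≤
      (f ^ 2 * G) / (2 * (u + v) * Real.pi * (k + 2)) := by
    intro q hq
    rw [div_le_div_iff₀ (by positivity) (by positivity)]
    have : 0 < f ^ 2 * G * Real.pi * (k + 2) := by positivity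
    linarith
  rw [boundConst]
  split_ifs with h1 h2
  · exact le_rfl
  · rw [pow_succ' 2 (2 * m)]
    exact hkey (2 ^ (2 * m)) (by positivity)
  · rw [hfac, mul_pow]
    exact hkey ((m : ℝ) ^ 2) (by positivity)

/-- The second moment bound of `second_moment_lower_bound` with the radius made explicit. -/
lemma second_moment_lower_bound_rpow {k : ℕ} (hk : 1 ≤ k) (P : Finset (Fin k → ℤ))
    (c : Fin k → ℝ) :
    (#P : ℝ) * (k / (k + 2) * ((#P : ℝ) ^ ((2 : ℝ) / k) *
        Real.Gamma ((k : ℝ) / 2 + 1) ^ ((2 : ℝ) / k) / Real.pi) - k / 12) ≤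
      ∑ x ∈ P, ∑ j, ((x j : ℝ) - c j) ^ 2 := by
  have hk' : (k : ℝ) ≠ 0 := by positivity
  have hV := unitBallVolume_pos k
  have hΓ : 0 < Real.Gamma ((k : ℝ) / 2 + 1) := Real.Gamma_pos_of_pos (by positivity)
  have h0 : 0 ≤ (#P : ℝ) / unitBallVolume k := by positivity
  have h := second_moment_lower_bound hk P c (R := ((#P : ℝ) / unitBallVolume k) ^ (1 / (k : ℝ)))
    (by positivity) (by
      rw [← Real.rpow_mul_natCast h0, one_div_mul_cancel hk', Real.rpow_one,
        mul_div_cancel₀ _ hV.ne'])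
  have hR : (((#P : ℝ) / unitBallVolume k) ^ (1 / (k : ℝ))) ^ 2 =
      (#P : ℝ) ^ ((2 : ℝ) / k) * Real.Gamma ((k : ℝ) / 2 + 1) ^ ((2 : ℝ) / k) / Real.pi := by
    have hpi : (√Real.pi ^ k) ^ ((2 : ℝ) / k) = Real.pi := by
      rw [← Real.rpow_natCast, ← Real.rpow_mul (Real.sqrt_nonneg _), mul_div_cancel₀ _ hk',
        Real.rpow_two, Real.sq_sqrt Real.pi_pos.le]
    rw [← Real.rpow_mul_natCast h0, unitBallVolume, div_div_eq_mul_div,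
      show 1 / (k : ℝ) * (2 : ℕ) = 2 / k by push_cast; ring,
      Real.div_rpow (by positivity) (by positivity), Real.mul_rpow (by positivity) hΓ.le, hpi]
  rwa [hR] at h

lemma eval_apply_cast {n k : ℕ} (m : ℕ) (a : Fin n → Fin k → ℤ) (A : Finset (Fin n)) (j : Fin k) :
    ((eval m a A j : ℤ) : ℝ) = realEval m (fun i => (a i j : ℝ)) A := by
  simp [eval, realEval, Finset.sum_apply, Finset.prod_apply]

/-- Comparison of the two estimates of the second moment of the evaluations. -/
lemma boundConst_mul_errorFactor_le {k m n : ℕ} {lam : ℝ} (hk : 1 ≤ k) (hm : 1 ≤ m) (hn : 1 ≤ n)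
    (hlam0 : 0 < lam) (hlam1 : lam ≤ 1) (hmn : m ≤ n) {s₀ : ℕ} (hs₀ : (s₀ : ℝ) ≤ lam * n)
    (hsize : ∑ A ∈ smallSets lam n, ((#A : ℝ) - s₀) ^ 2 ≤
      (1 + 2 * lam) * lam * n * #(smallSets lam n))
    {M : ℝ} (hM : 0 ≤ M) {a : Fin n → Fin k → ℤ} (ha : IsBounded M a)
    (hdist : IsEvalDistinct lam m a) :
    (((m - 1).factorial : ℝ) ^ 2 * Real.Gamma ((k : ℝ) / 2 + 1) ^ ((2 : ℝ) / k)) /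
        (2 * (lam ^ (2 * m - 1) + lam ^ (2 * m)) * Real.pi * ((k : ℝ) + 2)) *
      (errorFactor k m lam n * (#(smallSets lam n) : ℝ) ^ ((2 : ℝ) / k) / (n : ℝ) ^ (2 * m - 1)) ≤
        M ^ (2 * m) := by
  set c : Fin k → ℝ := fun j => sliceMean m (fun i => (a i j : ℝ)) s₀ with hc
  set F' := {A ∈ smallSets lam n | m ≤ #A} with hF'
  have hinj : Set.InjOn (eval m a) F' := by
    intro A hA B hB hAB
    simp only [hF', coe_filter, Set.mem_ofPred_eq] at hA hB
    by_contra hne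
    exact hdist A hA.1 B hB.1 hA.2 hB.2 hne hAB
  have h1 := second_moment_lower_bound_rpow hk (F'.image (eval m a)) c
  rw [card_image_of_injOn hinj, sum_image hinj] at h1
  have h2 : ∑ A ∈ F', ∑ j, ((eval m a A j : ℝ) - c j) ^ 2 ≤
      ∑ j, ∑ A ∈ smallSets lam n, ((eval m a A j : ℝ) - c j) ^ 2 := by
    rw [sum_comm (s := univ)]
    exact sum_le_sum_of_subset_of_nonneg (filter_subset _ _) fun _ _ _ =>
      sum_nonneg fun _ _ => sq_nonneg _
  have hN : (0 : ℝ) < #(smallSets lam n) := by exact_mod_cast one_le_card_smallSets hlam0.le n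
  have hNL : (#F' : ℝ) = numLarge lam m n := rfl
  set N : ℝ := (#(smallSets lam n) : ℝ)
  set f : ℝ := ((m - 1).factorial : ℝ) with hf
  have hf0 : 0 < f := by rw [hf]; positivity
  have h3 : ∀ j ∈ (univ : Finset (Fin k)),
      ∑ A ∈ smallSets lam n, ((eval m a A j : ℝ) - c j) ^ 2 ≤
        M ^ (2 * m) * (2 * (lam ^ (2 * m - 1) + lam ^ (2 * m))) * (n : ℝ) ^ (2 * m - 1) / f ^ 2 *
          N := by
    intro j _
    simp_rw [eval_apply_cast]
    refine (sum_smallSets_sq_le hlam0.le hlam1 hm (fun i => by exact_mod_cast (ha i j).1)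
      (fun i => (ha i j).2) hM hmn hs₀).trans ?_
    calc _ ≤ M ^ (2 * m) * (lam * n) ^ (2 * m - 2) / f ^ 2 *
          (lam * n * N + (1 + 2 * lam) * lam * n * N) := by gcongr
      _ = _ := by
        obtain ⟨l, rfl⟩ := Nat.exists_eq_add_of_le' hm
        rw [show 2 * (l + 1) - 2 = 2 * l by omega, show 2 * (l + 1) - 1 = 2 * l + 1 by omega,
          show 2 * (l + 1) = 2 * l + 1 + 1 by omega]
        ring
  have h4 := h1.trans (h2.trans (sum_le_sum h3))
  rw [sum_const, card_univ, Fintype.card_fin, nsmul_eq_mul, hNL] at h4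
  have hG : 0 < Real.Gamma ((k : ℝ) / 2 + 1) ^ ((2 : ℝ) / k) :=
    Real.rpow_pos_of_pos (Real.Gamma_pos_of_pos (by positivity)) _
  have hpi := Real.pi_pos
  have hk' : (0 : ℝ) < k := by exact_mod_cast hk
  have hn' : (0 : ℝ) < n := by exact_mod_cast hn
  set G := Real.Gamma ((k : ℝ) / 2 + 1) ^ ((2 : ℝ) / k) with hGdef
  set B := 2 * (lam ^ (2 * m - 1) + lam ^ (2 * m)) with hB
  have hB0 : 0 < B := by positivity
  set N' : ℝ := (numLarge lam m n : ℝ) with hN'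
  have h5 : errorFactor k m lam n * N ^ ((2 : ℝ) / k) * N =
      N' * (N' ^ ((2 : ℝ) / k) - Real.pi * (k + 2) / (12 * G)) := by
    have hNk : (0 : ℝ) < N ^ ((2 : ℝ) / k) := Real.rpow_pos_of_pos hN _
    have hdef : errorFactor k m lam n = N' / N * ((N' / N) ^ ((2 : ℝ) / k) -
        Real.pi * (k + 2) / (12 * G) * N ^ (-((2 : ℝ) / k))) := rfl
    rw [hdef, Real.div_rpow (by positivity) hN.le, Real.rpow_neg hN.le]
    field_simp
  have h6 : errorFactor k m lam n * N ^ ((2 : ℝ) / k) * N * (k * G / ((k + 2) * Real.pi)) ≤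
      M ^ (2 * m) * (k * (B * (n : ℝ) ^ (2 * m - 1) / f ^ 2)) * N := by
    rw [h5]
    refine le_trans (le_of_eq ?_) (h4.trans (le_of_eq ?_))
    · field_simp
    · ring
  have h7 : errorFactor k m lam n * N ^ ((2 : ℝ) / k) * (k * G / ((k + 2) * Real.pi)) ≤
      M ^ (2 * m) * (k * (B * (n : ℝ) ^ (2 * m - 1) / f ^ 2)) := by
    refine le_of_mul_le_mul_right ?_ hN
    calc _ = _ := by ring
      _ ≤ _ := h6
  rw [← div_le_iff₀ (by positivity)] at h7
  refine le_trans (le_of_eq ?_) h7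
  field_simp

end SymmEval

theorem theorem3p6 (k m : ℕ) (lam : ℝ) (hk : 1 ≤ k) (hm : 1 ≤ m)
    (hlam0 : 0 < lam) (hlam1 : lam ≤ 1) :
    ∃ ε : ℕ → ℝ, Filter.Tendsto ε Filter.atTop (nhds 0) ∧
      ∀ n : ℕ, 1 ≤ n → ∀ (M : ℝ) (a : Fin n → Fin k → ℤ),
        SymmEval.IsBounded M a → SymmEval.IsEvalDistinct lam m a →
          M ^ (2 * m) ≥
            SymmEval.boundConst k m lam *
              ((1 + ε n) * ((SymmEval.smallSets lam n).card : ℝ) ^ ((2 : ℝ) / k) /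
                (n : ℝ) ^ (2 * m - 1)) := by
  obtain ⟨n₀, hn₀⟩ := Filter.eventually_atTop.1
    ((SymmEval.eventually_exists_sum_size_sq_le hlam0).and (Filter.eventually_ge_atTop m))
  -- `ε n = -1` makes the bound trivial for the finitely many `n` below `n₀`
  refine ⟨fun n => if n₀ ≤ n then max (SymmEval.errorFactor k m lam n - 1) (-1) else -1, ?_, ?_⟩
  · have h1 : Filter.Tendsto (fun n => max (SymmEval.errorFactor k m lam n - 1) (-1))
        Filter.atTop (nhds 0) := by
      have := ((SymmEval.tendsto_errorFactor (k := k) hk hm hlam0).sub_const 1).max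
        (tendsto_const_nhds (x := (-1 : ℝ)))
      simpa using this
    refine h1.congr' ?_
    filter_upwards [Filter.eventually_ge_atTop n₀] with n hn
    rw [if_pos hn]
  · intro n hn M a ha hdist
    have hM : 0 ≤ M := by
      have h := ha ⟨0, hn⟩ ⟨0, hk⟩
      exact le_trans (by exact_mod_cast h.1) h.2
    have htriv : 0 ≤ M ^ (2 * m) := by positivity
    dsimp only
    split_ifs with hnn
    · obtain ⟨⟨s₀, hs₀, hsize⟩, hmn⟩ := hn₀ n hnn
      rcases le_total (SymmEval.errorFactor k m lam n - 1) (-1) with he | he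
      · rw [max_eq_right he]
        simpa using htriv
      · rw [max_eq_left he, add_sub_cancel]
        have he' : 0 ≤ SymmEval.errorFactor k m lam n := by linarith
        exact (mul_le_mul_of_nonneg_right (SymmEval.boundConst_le hm hlam0) (by positivity)).trans
          (SymmEval.boundConst_mul_errorFactor_le hk hm hn hlam0 hlam1 hmn hs₀ hsize hM ha hdist)
    · simpa using htriv
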